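/- **Equivalence Theorem.** By a simply connected plane domain we mean a nonempty open simply connected set $\Omega\subset\mathbb C=\mathbb R^2$ with nonempty boundary; $\mathbb D$ is the open unit disc, and a conformal homeomorphism $\varphi:\Omega\to\mathbb D$ is a holomorphic bijection of $\Omega$ onto $\mathbb D$ (its inverse is then holomorphic). For an open set $U\subset\mathbb R^2$ and $1\le p<\infty$, $L^1_p(U)$ is the space of locally integrable, weakly differentiable functions $f:U\to\mathbb R$ with finite seminorm $\|f\|_{L^1_p(U)}=\big(\int_U|\nabla f|^p\,d\mu\big)^{1/p}$, where $\mu$ is Lebesgue measure. We say that $\varphi$ generates a bounded composition operator $\varphi^*:L^1_p(\mathbb D)\to L^1_q(\Omega)$ if $f\circ\varphi\in L^1_q(\Omega)$ for every $f\in L^1_p(\mathbb D)$ and there is a constant $K<\infty$ such that $\|f\circ\varphi\|_{L^1_q(\Omega)}\le K\|f\|_{L^1_p(\mathbb D)}$ for all $f\in L^1_p(\mathbb D)$. Let $s\in(4/3,4)$. Then the following two conditions are equivalent: 1. for every simply connected plane domain $\Omega$ with nonempty boundary and every conformal homeomorphism $\varphi:\Omega\to\mathbb D$, $\int_\Omega|\varphi'(z)|^s\,d\mu<\infty$;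 2. for every simply connected plane domain $\Omega$ with nonempty boundary and every conformal homeomorphism $\varphi:\Omega\to\mathbb D$, $\varphi$ generates a bounded composition operator $\varphi^*:L^1_p(\mathbb D)\to L^1_q(\Omega)$ for every $p\in(2,\infty)$, where $q=q(p,s)=\dfrac{ps}{p+s-2}$. Moreover, the equivalence holds for each domain separately: for every simply connected plane domain $\Omega$ with nonempty boundary, $\int_\Omega|\varphi'|^s\,d\mu<\infty$ holds for all conformal homeomorphisms $\varphi:\Omega\to\mathbb D$ if and only if every conformal homeomorphism $\varphi:\Omega\to\mathbb D$ generates a bounded composition operator $\varphi^*:L^1_p(\mathbb D)\to L^1_{q(p,s)}(\Omega)$ for every $p\in(2,\infty)$. -/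

import Mathlib

open MeasureTheory Set
open scoped ENNReal NNReal

noncomputable section

namespace Brennan

/-- A simply connected plane domain with nonempty boundary. -/
structure IsPlaneDomain (Ω : Set ℂ) : Prop where
  isOpen : IsOpen Ω
  simplyConnected : IsSimplyConnected Ω
  frontier_nonempty : (frontier Ω).Nonempty

/-- The open unit disc. -/
abbrev disc : Set ℂ := Metric.ball (0 : ℂ) 1

/-- `φ` restricts to a conformal homeomorphism of the open set `Ω` onto `Ω'`: a holomorphic bijection
with nonvanishing derivative. (The inverse is then holomorphic, in particular continuous, by the
inverse function theorem.) The values of `φ` outside `Ω` play no role. -/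
structure IsConformalHomeo (φ : ℂ → ℂ) (Ω Ω' : Set ℂ) : Prop where
  differentiableOn : DifferentiableOn ℂ φ Ω
  deriv_ne_zero : ∀ z ∈ Ω, deriv φ z ≠ 0
  bijOn : BijOn φ Ω Ω'

/-- Brennan's integrability condition `∫_Ω |φ'|^s < ∞`. -/
def BrennanIntegrable (φ : ℂ → ℂ) (Ω : Set ℂ) (s : ℝ) : Prop :=
  ∫⁻ z in Ω, ‖deriv φ z‖ₑ ^ s < ∞

/-- `g` is a weak gradient of the locally summable function `f` on the open set `Ω`, where `ℂ` is
identified with `ℝ²`, so that `g = ∂f/∂x + i ∂f/∂y` and `inner ℝ (g z) v` is the derivative of `f`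
in the direction `v`. Only the values on `Ω` matter. -/
structure HasWeakGradient (f : ℂ → ℝ) (g : ℂ → ℂ) (Ω : Set ℂ) : Prop where
  locallyIntegrableOn : LocallyIntegrableOn f Ω
  locallyIntegrableOn_gradient : LocallyIntegrableOn g Ω
  integral_eq : ∀ η : ℂ → ℝ, ContDiff ℝ (⊤ : ℕ∞) η → HasCompactSupport η → tsupport η ⊆ Ω → ∀ v : ℂ,
    ∫ z in Ω, f z * fderiv ℝ η z v = - ∫ z in Ω, inner ℝ (g z) v * η z

/-- The seminorm of `L^1_p(Ω)`, i.e. the `L^p(Ω)` norm of the weak gradient. A weak gradient is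
unique almost everywhere on `Ω`, so the infimum is over one value (see `seminorm_eq`); it is `∞` if
there is no weak gradient. -/
def seminormL1 (Ω : Set ℂ) (p : ℝ≥0∞) (f : ℂ → ℝ) : ℝ≥0∞ :=
  ⨅ (g : ℂ → ℂ) (_ : HasWeakGradient f g Ω), eLpNorm g p (volume.restrict Ω)

/-- `f` belongs to the homogeneous Sobolev space `L^1_p(Ω)`: it is locally summable and weakly
differentiable on `Ω`, with finite seminorm. -/
def MemL1 (Ω : Set ℂ) (p : ℝ≥0∞) (f : ℂ → ℝ) : Prop :=
  (∃ g, HasWeakGradient f g Ω) ∧ seminormL1 Ω p f < ∞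

/-- `φ` generates a bounded composition operator `φ* : L^1_p(Ω') → L^1_q(Ω)`, `φ* f = f ∘ φ`. -/
def GeneratesBoundedComposition (φ : ℂ → ℂ) (Ω Ω' : Set ℂ) (p q : ℝ≥0∞) : Prop :=
  (∀ f : ℂ → ℝ, MemL1 Ω' p f → MemL1 Ω q (f ∘ φ)) ∧
    ∃ K : ℝ≥0, ∀ f : ℂ → ℝ, MemL1 Ω' p f → seminormL1 Ω q (f ∘ φ) ≤ K * seminormL1 Ω' p f

/-- Weak gradients are unique up to null sets. -/
theorem HasWeakGradient.ae_eq {f : ℂ → ℝ} {g h : ℂ → ℂ} {Ω : Set ℂ} (hΩ : IsOpen Ω)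
    (hg : HasWeakGradient f g Ω) (hh : HasWeakGradient f h Ω) :
    g =ᵐ[volume.restrict Ω] h := by
  have hd : LocallyIntegrableOn (fun z => g z - h z) Ω :=
    hg.locallyIntegrableOn_gradient.sub hh.locallyIntegrableOn_gradient
  have key : ∀ᵐ z, z ∈ Ω → g z - h z = 0 := by
    refine hΩ.ae_eq_zero_of_integral_contDiff_smul_eq_zero hd fun η hη hc hs => ?_
    have int : ∀ {k : ℂ → ℂ}, LocallyIntegrableOn k Ω → IntegrableOn (fun z => η z • k z) Ω := by
      intro k hk
      have h1 : IntegrableOn (fun z => η z • k z) (tsupport η) :=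
        (hk.integrableOn_compact_subset hs hc).continuousOn_smul hη.continuous.continuousOn hc
      refine (integrableOn_iff_integrable_of_support_subset ?_).1 h1 |>.integrableOn
      exact (Function.support_smul_subset_left η k).trans (subset_tsupport η)
    have hi : IntegrableOn (fun z => η z • (g z - h z)) Ω := int hd
    have h0 : ∫ z in Ω, η z • (g z - h z) = 0 := by
      refine ext_inner_left ℝ fun v => ?_
      have e := hg.integral_eq η hη hc hs v
      rw [hh.integral_eq η hη hc hs v, neg_inj] at e
      rw [← integral_inner hi v, inner_zero_right]
      have e1 : ∀ z, inner ℝ v (η z • (g z - h z))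
          = inner ℝ v (η z • g z) - inner ℝ v (η z • h z) := by
        intro z; rw [smul_sub, inner_sub_right]
      simp_rw [e1]
      rw [integral_sub ((int hg.locallyIntegrableOn_gradient).const_inner v)
        ((int hh.locallyIntegrableOn_gradient).const_inner v), sub_eq_zero]
      simp_rw [inner_smul_right, real_inner_comm _ v]
      simpa only [mul_comm, real_inner_comm] using e.symm
    rw [← h0, setIntegral_eq_integral_of_forall_compl_eq_zero]
    intro z hz
    rw [image_eq_zero_of_notMem_tsupport (fun h => hz (hs h)), zero_smul]
  filter_upwards [(ae_restrict_iff' hΩ.measurableSet).2 key] with z hz using sub_eq_zero.1 hz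

theorem seminorm_eq {f : ℂ → ℝ} {g : ℂ → ℂ} {Ω : Set ℂ} (hΩ : IsOpen Ω)
    (hg : HasWeakGradient f g Ω) (p : ℝ≥0∞) :
    seminormL1 Ω p f = eLpNorm g p (volume.restrict Ω) := by
  refine le_antisymm (iInf₂_le g hg) (le_iInf₂ fun h hh => ?_)
  exact (eLpNorm_congr_ae (hg.ae_eq hΩ hh)).le

end Brennan

end

noncomputable section

namespace Brennan

open Filter Topology ComplexConjugate

/-! The equivalence holds for each single `φ`. A conformal `φ` has Jacobian `|φ'|²` and satisfies
`|∇(f ∘ φ)| = |φ'| · |∇f| ∘ φ`, also for weak gradients (`HasWeakGradient.comp`). Hölder's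
inequality and the change of variables then bound the operator by a power of `∫ |φ'|^s`
(`eLpNorm_pullbackGradient_le`).

Conversely, applying the operator to `u sin(nx + c) / n` and letting `n → ∞` replaces gradients by
arbitrary test functions: `‖|φ'| · u ∘ φ‖_q ≤ 2K ‖u‖_p` (`eLpNorm_pullback_ofReal_le`). With `ψ =
φ⁻¹` and a cutoff `χ`, the choice `u = χ |ψ'|^((2 - s) / p)` makes both sides powers of a truncated
integral `I` of `|φ'|^s`: `I^(1/q) ≤ 2K I^(1/p)`. As `q < p` and `I` is finite, `I` is bounded
independently of `χ` (`lintegral_cutoff_le`), and exhausting the disc gives the claim. -/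

theorem det_restrictScalars_toSpanSingleton (c : ℂ) :
    ((ContinuousLinearMap.toSpanSingleton ℂ c).restrictScalars ℝ).det = ‖c‖ ^ 2 := by
  have h : (((ContinuousLinearMap.toSpanSingleton ℂ c).restrictScalars ℝ : ℂ →L[ℝ] ℂ) : ℂ →ₗ[ℝ] ℂ)
      = ((ContinuousLinearMap.toSpanSingleton ℂ c : ℂ →L[ℂ] ℂ) : ℂ →ₗ[ℂ] ℂ).restrictScalars ℝ := rfl
  rw [ContinuousLinearMap.det, h, LinearMap.det_restrictScalars, LinearMap.det_ring,
    Algebra.norm_complex_apply, Complex.normSq_eq_norm_sq]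
  simp

/-- A function that is smooth on an open set and vanishes there off a compact subset extends by zero
to a smooth function. -/
theorem contDiff_indicator {U K : Set ℂ} {F : ℂ → ℝ} (hU : IsOpen U) (hK : IsCompact K)
    (hKU : K ⊆ U) (hF : ContDiffOn ℝ (⊤ : ℕ∞) F U) (h0 : ∀ z ∈ U, z ∉ K → F z = 0) :
    ContDiff ℝ (⊤ : ℕ∞) (U.indicator F) := by
  refine contDiff_iff_contDiffAt.2 fun z => ?_
  by_cases hz : z ∈ U
  · refine (hF.contDiffAt (hU.mem_nhds hz)).congr_of_eventuallyEq ?_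
    filter_upwards [hU.mem_nhds hz] with w hw using indicator_of_mem hw F
  · have : U.indicator F =ᶠ[𝓝 z] fun _ => 0 := by
      filter_upwards [hK.isClosed.isOpen_compl.mem_nhds fun h => hz (hKU h)] with w hw
      by_cases hwU : w ∈ U
      · rw [indicator_of_mem hwU, h0 w hwU hw]
      · exact indicator_of_notMem hwU F
    exact contDiffAt_const.congr_of_eventuallyEq this

theorem tsupport_indicator_subset {U K : Set ℂ} {F : ℂ → ℝ} (hK : IsCompact K)
    (h0 : ∀ z ∈ U, z ∉ K → F z = 0) : tsupport (U.indicator F) ⊆ K := by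
  refine closure_minimal (fun z hz => ?_) hK.isClosed
  by_contra h
  refine hz ?_
  by_cases hzU : z ∈ U
  · rw [indicator_of_mem hzU, h0 z hzU h]
  · exact indicator_of_notMem hzU F

/-- The product of a locally integrable function with a compactly supported continuous function is
integrable. -/
theorem integrableOn_smul_of_hasCompactSupport {E : Type*} [NormedAddCommGroup E] [NormedSpace ℝ E]
    {U : Set ℂ} {k : ℂ → E} {η : ℂ → ℝ} (hk : LocallyIntegrableOn k U) (hη : Continuous η)
    (hc : HasCompactSupport η) (hs : tsupport η ⊆ U) :
    IntegrableOn (fun z => η z • k z) U := by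
  have h1 : IntegrableOn (fun z => η z • k z) (tsupport η) :=
    (hk.integrableOn_compact_subset hs hc).continuousOn_smul hη.continuousOn hc
  refine (integrableOn_iff_integrable_of_support_subset ?_).1 h1 |>.integrableOn
  exact (Function.support_smul_subset_left η k).trans (subset_tsupport η)

/-! ### Inverse of a conformal homeomorphism and change of variables -/

namespace IsConformalHomeo

variable {φ : ℂ → ℂ} {Ω Ω' : Set ℂ}

theorem hasDerivAt (h : IsConformalHomeo φ Ω Ω') (hΩ : IsOpen Ω) {z : ℂ} (hz : z ∈ Ω) :
    HasDerivAt φ (deriv φ z) z :=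
  (h.differentiableOn.differentiableAt (hΩ.mem_nhds hz)).hasDerivAt

theorem hasFDerivWithinAt (h : IsConformalHomeo φ Ω Ω') (hΩ : IsOpen Ω) {K : Set ℂ} :
    ∀ z ∈ Ω, HasFDerivWithinAt φ
      ((ContinuousLinearMap.toSpanSingleton ℂ (deriv φ z)).restrictScalars ℝ) K z :=
  fun _ hz => ((h.hasDerivAt hΩ hz).hasFDerivAt.restrictScalars ℝ).hasFDerivWithinAt

theorem continuousOn_deriv (h : IsConformalHomeo φ Ω Ω') (hΩ : IsOpen Ω) :
    ContinuousOn (deriv φ) Ω :=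
  (h.differentiableOn.deriv hΩ).continuousOn

theorem map_nhds_eq (h : IsConformalHomeo φ Ω Ω') (hΩ : IsOpen Ω) {z : ℂ} (hz : z ∈ Ω) :
    map φ (𝓝 z) = 𝓝 (φ z) :=
  ((h.differentiableOn.analyticAt (hΩ.mem_nhds hz)).hasStrictDerivAt).map_nhds_eq
    (h.deriv_ne_zero z hz)

theorem isOpen_target (h : IsConformalHomeo φ Ω Ω') (hΩ : IsOpen Ω) : IsOpen Ω' := by
  rw [isOpen_iff_mem_nhds, ← h.bijOn.image_eq]
  rintro _ ⟨z, hz, rfl⟩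
  rw [← h.map_nhds_eq hΩ hz]
  exact image_mem_map (hΩ.mem_nhds hz)

theorem invFunOn_apply (h : IsConformalHomeo φ Ω Ω') {z : ℂ} (hz : z ∈ Ω) :
    Function.invFunOn φ Ω (φ z) = z :=
  h.bijOn.injOn.leftInvOn_invFunOn hz

theorem apply_invFunOn (h : IsConformalHomeo φ Ω Ω') {w : ℂ} (hw : w ∈ Ω') :
    φ (Function.invFunOn φ Ω w) = w :=
  h.bijOn.surjOn.rightInvOn_invFunOn hw

theorem invFunOn_mem (h : IsConformalHomeo φ Ω Ω') {w : ℂ} (hw : w ∈ Ω') :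
    Function.invFunOn φ Ω w ∈ Ω :=
  h.bijOn.surjOn.mapsTo_invFunOn hw

theorem hasDerivAt_invFunOn (h : IsConformalHomeo φ Ω Ω') (hΩ : IsOpen Ω) {z : ℂ} (hz : z ∈ Ω) :
    HasDerivAt (Function.invFunOn φ Ω) (deriv φ z)⁻¹ (φ z) := by
  -- Continuity of the inverse is the openness of `φ` at `z`, in the form `map φ (𝓝 z) = 𝓝 (φ z)`.
  have hc : ContinuousAt (Function.invFunOn φ Ω) (φ z) := by
    rw [ContinuousAt, ← h.map_nhds_eq hΩ hz, tendsto_map'_iff, h.invFunOn_apply hz]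
    refine tendsto_id.congr' ?_
    filter_upwards [hΩ.mem_nhds hz] with w hw using (h.invFunOn_apply hw).symm
  refine HasDerivAt.of_local_left_inverse (f := φ) hc ?_ (h.deriv_ne_zero z hz) ?_
  · rw [h.invFunOn_apply hz]; exact h.hasDerivAt hΩ hz
  · filter_upwards [(h.isOpen_target hΩ).mem_nhds (h.bijOn.mapsTo hz)] with w hw
      using h.apply_invFunOn hw

theorem deriv_invFunOn (h : IsConformalHomeo φ Ω Ω') (hΩ : IsOpen Ω) {z : ℂ} (hz : z ∈ Ω) :
    deriv (Function.invFunOn φ Ω) (φ z) = (deriv φ z)⁻¹ :=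
  (h.hasDerivAt_invFunOn hΩ hz).deriv

theorem invFunOn (h : IsConformalHomeo φ Ω Ω') (hΩ : IsOpen Ω) :
    IsConformalHomeo (Function.invFunOn φ Ω) Ω' Ω where
  differentiableOn w hw := by
    have := h.hasDerivAt_invFunOn hΩ (h.invFunOn_mem hw)
    rw [h.apply_invFunOn hw] at this
    exact this.differentiableAt.differentiableWithinAt
  deriv_ne_zero w hw := by
    have := h.deriv_invFunOn hΩ (h.invFunOn_mem hw)
    rw [h.apply_invFunOn hw] at this
    rw [this]
    exact inv_ne_zero (h.deriv_ne_zero _ (h.invFunOn_mem hw))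
  bijOn := ⟨fun _ hw => h.invFunOn_mem hw,
    fun w hw w' hw' e => by rw [← h.apply_invFunOn hw, e, h.apply_invFunOn hw'],
    fun z hz => ⟨φ z, h.bijOn.mapsTo hz, h.invFunOn_apply hz⟩⟩

theorem lintegral_comp (h : IsConformalHomeo φ Ω Ω') (hΩ : IsOpen Ω) (F : ℂ → ℝ≥0∞) :
    ∫⁻ w in Ω', F w = ∫⁻ z in Ω, ‖deriv φ z‖ₑ ^ 2 * F (φ z) := by
  rw [← h.bijOn.image_eq, lintegral_image_eq_lintegral_abs_det_fderiv_mul volume hΩ.measurableSet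
    (h.hasFDerivWithinAt hΩ) h.bijOn.injOn]
  refine setLIntegral_congr_fun hΩ.measurableSet fun z _ => ?_
  rw [det_restrictScalars_toSpanSingleton, abs_of_nonneg (by positivity),
    ENNReal.ofReal_pow (norm_nonneg _), ofReal_norm]

theorem integral_comp (h : IsConformalHomeo φ Ω Ω') (hΩ : IsOpen Ω) (F : ℂ → ℝ) :
    ∫ w in Ω', F w = ∫ z in Ω, ‖deriv φ z‖ ^ 2 * F (φ z) := by
  rw [← h.bijOn.image_eq, integral_image_eq_integral_abs_det_fderiv_smul volume hΩ.measurableSet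
    (h.hasFDerivWithinAt hΩ) h.bijOn.injOn]
  refine setIntegral_congr_fun hΩ.measurableSet fun z _ => ?_
  rw [det_restrictScalars_toSpanSingleton, abs_of_nonneg (by positivity), smul_eq_mul]

/-- The change of variables gives integrability of `|φ'|² F ∘ φ` on a compact set, where `|φ'|` is
bounded away from zero and the Jacobian can be divided out. -/
theorem locallyIntegrableOn_comp {E : Type*} [NormedAddCommGroup E] [NormedSpace ℝ E]
    (h : IsConformalHomeo φ Ω Ω') (hΩ : IsOpen Ω) {F : ℂ → E} (hF : LocallyIntegrableOn F Ω') :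
    LocallyIntegrableOn (fun z => F (φ z)) Ω := by
  refine (locallyIntegrableOn_iff hΩ.isLocallyClosed).2 fun K hK hc => ?_
  have h1 : IntegrableOn F (φ '' K) := hF.integrableOn_compact_subset
    ((image_mono hK).trans h.bijOn.image_eq.le)
    (hc.image_of_continuousOn (h.differentiableOn.continuousOn.mono hK))
  rw [integrableOn_image_iff_integrableOn_abs_det_fderiv_smul volume hc.measurableSet
    (fun z hz => h.hasFDerivWithinAt hΩ z (hK hz)) (h.bijOn.injOn.mono hK)] at h1
  have h2 : ContinuousOn (fun z => (‖deriv φ z‖ ^ 2)⁻¹) K :=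
    (((h.continuousOn_deriv hΩ).mono hK).norm.pow 2).inv₀ fun z hz =>
      pow_ne_zero 2 (norm_ne_zero_iff.2 (h.deriv_ne_zero z (hK hz)))
  refine (h1.continuousOn_smul h2 hc).congr_fun (fun z hz => ?_) hc.measurableSet
  beta_reduce
  rw [det_restrictScalars_toSpanSingleton, abs_of_nonneg (by positivity), inv_smul_smul₀]
  exact pow_ne_zero 2 (norm_ne_zero_iff.2 (h.deriv_ne_zero z (hK hz)))

theorem contDiffOn (h : IsConformalHomeo φ Ω Ω') (hΩ : IsOpen Ω) :
    ContDiffOn ℝ (⊤ : ℕ∞) φ Ω :=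
  (h.differentiableOn.contDiffOn hΩ).restrict_scalars ℝ

theorem contDiffOn_deriv (h : IsConformalHomeo φ Ω Ω') (hΩ : IsOpen Ω) :
    ContDiffOn ℝ (⊤ : ℕ∞) (deriv φ) Ω :=
  ((h.differentiableOn.deriv hΩ).contDiffOn hΩ).restrict_scalars ℝ

end IsConformalHomeo

/-! ### Chain rule for weak gradients -/

/-- The gradient of `f ∘ φ` in terms of the gradient `g` of `f`, for holomorphic `φ`. -/
def pullbackGradient (φ g : ℂ → ℂ) (z : ℂ) : ℂ := conj (deriv φ z) * g (φ z)

namespace IsConformalHomeo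

variable {φ : ℂ → ℂ} {Ω Ω' : Set ℂ}

theorem locallyIntegrableOn_pullbackGradient (h : IsConformalHomeo φ Ω Ω') (hΩ : IsOpen Ω)
    {g : ℂ → ℂ} (hg : LocallyIntegrableOn g Ω') :
    LocallyIntegrableOn (pullbackGradient φ g) Ω :=
  (h.locallyIntegrableOn_comp hΩ hg).continuousOn_mul
    (Complex.continuous_conj.comp_continuousOn (h.continuousOn_deriv hΩ)) hΩ.isLocallyClosed

/-- The vector field `w ↦ v * conj (ψ' w)` is divergence free when `ψ` is holomorphic. -/
theorem fderiv_add_fderiv_eq {ψ : ℂ → ℂ} {η : ℂ → ℝ} {w c : ℂ} (v : ℂ)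
    (hψ : DifferentiableAt ℂ ψ w) (hψ' : HasDerivAt (deriv ψ) c w)
    (hη : DifferentiableAt ℝ η (ψ w)) :
    fderiv ℝ (fun w => (v * conj (deriv ψ w)).re * η (ψ w)) w 1
      + fderiv ℝ (fun w => (v * conj (deriv ψ w)).im * η (ψ w)) w Complex.I
      = ‖deriv ψ w‖ ^ 2 * fderiv ℝ η (ψ w) v := by
  have hX : HasFDerivAt (fun w => v * conj (deriv ψ w)) _ w :=
    ((Complex.conjCLE.toContinuousLinearMap.hasFDerivAt.comp w
      (hψ'.hasFDerivAt.restrictScalars ℝ)).const_mul v)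
  have hE : HasFDerivAt (fun w => η (ψ w)) _ w :=
    hη.hasFDerivAt.comp w (hψ.hasDerivAt.hasFDerivAt.restrictScalars ℝ)
  have h1 : HasFDerivAt (fun w => (v * conj (deriv ψ w)).re * η (ψ w)) _ w :=
    (Complex.reCLM.hasFDerivAt.comp w hX).mul hE
  have h2 : HasFDerivAt (fun w => (v * conj (deriv ψ w)).im * η (ψ w)) _ w :=
    (Complex.imCLM.hasFDerivAt.comp w hX).mul hE
  rw [h1.fderiv, h2.fderiv]
  -- With `X = v * conj ψ'` one has `ψ' * X = |ψ'|² v`; expanding `X = X.re + I * X.im` gives the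
  -- two directional derivatives.
  have e : ‖deriv ψ w‖ ^ 2 * fderiv ℝ η (ψ w) v
      = (v * conj (deriv ψ w)).re * fderiv ℝ η (ψ w) (deriv ψ w)
        + (v * conj (deriv ψ w)).im * fderiv ℝ η (ψ w) (Complex.I * deriv ψ w) := by
    simp only [← smul_eq_mul (a := (_ : ℝ)), ← map_smul, ← map_add]
    congr 1
    rw [Complex.real_smul, Complex.real_smul, Complex.real_smul, ← mul_assoc, ← add_mul,
      mul_comm (_ : ℂ) Complex.I, mul_comm Complex.I, Complex.re_add_im, mul_assoc,
      mul_comm (conj _), Complex.mul_conj, Complex.normSq_eq_norm_sq, mul_comm]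
  rw [e]
  -- The terms in `c`, namely `Re (v * conj c)` and `Im (-I * v * conj c)`, cancel.
  simp
  ring

end IsConformalHomeo

/-- No smooth approximation of `f` is needed: the weak gradient of `f` is tested on `Ω'` against the
field `v * conj ψ' * (η ∘ ψ)`, where `ψ` is the inverse of `φ`. Its divergence is `|ψ'|² (∂_v η) ∘
ψ`, and pulling back by `φ` cancels `|ψ'|²` against the Jacobian. -/
theorem HasWeakGradient.comp {f : ℂ → ℝ} {g φ : ℂ → ℂ} {Ω Ω' : Set ℂ}
    (hg : HasWeakGradient f g Ω') (h : IsConformalHomeo φ Ω Ω') (hΩ : IsOpen Ω) :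
    HasWeakGradient (f ∘ φ) (pullbackGradient φ g) Ω where
  locallyIntegrableOn := h.locallyIntegrableOn_comp hΩ hg.locallyIntegrableOn
  locallyIntegrableOn_gradient :=
    h.locallyIntegrableOn_pullbackGradient hΩ hg.locallyIntegrableOn_gradient
  integral_eq η hη hc hs v := by
    have hΩ' := h.isOpen_target hΩ
    have hi := h.invFunOn hΩ
    set ψ := Function.invFunOn φ Ω with hψ
    set K := φ '' tsupport η
    have hK : IsCompact K := hc.isCompact.image_of_continuousOn
      (h.differentiableOn.continuousOn.mono hs)
    have hKΩ' : K ⊆ Ω' := (image_mono hs).trans h.bijOn.image_eq.le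
    have hηψ : ContDiffOn ℝ (⊤ : ℕ∞) (fun w => η (ψ w)) Ω' := hη.comp_contDiffOn (hi.contDiffOn hΩ')
    have hX : ContDiffOn ℝ (⊤ : ℕ∞) (fun w => v * conj (deriv ψ w)) Ω' :=
      contDiffOn_const.mul (Complex.conjCLE.contDiff.comp_contDiffOn (hi.contDiffOn_deriv hΩ'))
    have hη0 : ∀ w ∈ Ω', w ∉ K → η (ψ w) = 0 := fun w hw hwK =>
      image_eq_zero_of_notMem_tsupport fun hm => hwK ⟨ψ w, hm, h.apply_invFunOn hw⟩
    -- the two components of the test field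
    set F₁ : ℂ → ℝ := fun w => (v * conj (deriv ψ w)).re * η (ψ w)
    set F₂ : ℂ → ℝ := fun w => (v * conj (deriv ψ w)).im * η (ψ w)
    have hF₁ : ContDiffOn ℝ (⊤ : ℕ∞) F₁ Ω' := (Complex.reCLM.contDiff.comp_contDiffOn hX).mul hηψ
    have hF₂ : ContDiffOn ℝ (⊤ : ℕ∞) F₂ Ω' := (Complex.imCLM.contDiff.comp_contDiffOn hX).mul hηψ
    have h₁ : ∀ w ∈ Ω', w ∉ K → F₁ w = 0 := fun w hw hwK => by simp [F₁, hη0 w hw hwK]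
    have h₂ : ∀ w ∈ Ω', w ∉ K → F₂ w = 0 := fun w hw hwK => by simp [F₂, hη0 w hw hwK]
    -- The components of the field are smooth only on `Ω'`; since they vanish off the compact set
    -- `K`, their extension by zero is an admissible test function.
    have test : ∀ F : ℂ → ℝ, ContDiffOn ℝ (⊤ : ℕ∞) F Ω' → (∀ w ∈ Ω', w ∉ K → F w = 0) → ∀ u : ℂ,
        IntegrableOn (fun w => f w * fderiv ℝ F w u) Ω' ∧
        IntegrableOn (fun w => inner ℝ (g w) u * F w) Ω' ∧
        ∫ w in Ω', f w * fderiv ℝ F w u = - ∫ w in Ω', inner ℝ (g w) u * F w := by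
      intro F hF hF0 u
      have s := contDiff_indicator hΩ' hK hKΩ' hF hF0
      have ts := tsupport_indicator_subset hK hF0
      have hcs : HasCompactSupport (Ω'.indicator F) := hK.of_isClosed_subset isClosed_closure ts
      have e0 : ∀ w ∈ Ω', Ω'.indicator F w = F w := fun w hw => indicator_of_mem hw F
      have e1 : ∀ w ∈ Ω', fderiv ℝ (Ω'.indicator F) w = fderiv ℝ F w := fun w hw =>
        EventuallyEq.fderiv_eq (by filter_upwards [hΩ'.mem_nhds hw] with x hx using e0 x hx)
      refine ⟨?_, ?_, ?_⟩
      · refine (integrableOn_smul_of_hasCompactSupport hg.locallyIntegrableOn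
          (η := fun w => fderiv ℝ (Ω'.indicator F) w u) ?_ ?_ ?_).congr_fun
          (fun w hw => ?_) hΩ'.measurableSet
        · exact (s.continuous_fderiv (by simp)).clm_apply continuous_const
        · exact hcs.fderiv_apply ℝ u
        · exact ((tsupport_fderiv_apply_subset ℝ u).trans ts).trans hKΩ'
        · simp [e1 w hw, mul_comm]
      · refine (integrableOn_smul_of_hasCompactSupport hg.locallyIntegrableOn_gradient s.continuous
          hcs (ts.trans hKΩ')).inner_const (𝕜 := ℝ) u |>.congr ?_
        filter_upwards [ae_restrict_mem hΩ'.measurableSet] with w hw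
        simp [e0 w hw]
        ring
      · have := hg.integral_eq _ s hcs (ts.trans hKΩ') u
        rw [setIntegral_congr_fun hΩ'.measurableSet fun w hw => by
            rw [e1 w hw],
          setIntegral_congr_fun hΩ'.measurableSet
            (f := fun w => inner ℝ (g w) u * Ω'.indicator F w)
            fun w hw => by beta_reduce; rw [e0 w hw]] at this
        exact this
    obtain ⟨i₁, j₁, t₁⟩ := test F₁ hF₁ h₁ 1
    obtain ⟨i₂, j₂, t₂⟩ := test F₂ hF₂ h₂ Complex.I
    have key : ∫ w in Ω', f w * (‖deriv ψ w‖ ^ 2 * fderiv ℝ η (ψ w) v)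
        = - ∫ w in Ω', inner ℝ (g w) (v * conj (deriv ψ w)) * η (ψ w) := by
      have a : ∫ w in Ω', f w * (‖deriv ψ w‖ ^ 2 * fderiv ℝ η (ψ w) v)
          = ∫ w in Ω', (f w * fderiv ℝ F₁ w 1 + f w * fderiv ℝ F₂ w Complex.I) := by
        refine setIntegral_congr_fun hΩ'.measurableSet fun w hw => ?_
        rw [← mul_add, IsConformalHomeo.fderiv_add_fderiv_eq v
          (hi.hasDerivAt hΩ' hw).differentiableAt
          (((hi.differentiableOn.deriv hΩ').differentiableAt (hΩ'.mem_nhds hw)).hasDerivAt)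
          (hη.differentiable (by simp) _)]
      have b : ∫ w in Ω', inner ℝ (g w) (v * conj (deriv ψ w)) * η (ψ w)
          = ∫ w in Ω', (inner ℝ (g w) 1 * F₁ w + inner ℝ (g w) Complex.I * F₂ w) := by
        refine setIntegral_congr_fun hΩ'.measurableSet fun w _ => ?_
        simp only [Complex.inner, F₁, F₂, Complex.mul_re, Complex.mul_im, Complex.conj_re,
          Complex.conj_im, Complex.one_re, Complex.one_im, Complex.I_re, Complex.I_im]
        ring
      rw [a, b, integral_add i₁ i₂, integral_add j₁ j₂, t₁, t₂, neg_add]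
    rw [h.integral_comp hΩ, h.integral_comp hΩ] at key
    refine Eq.trans ?_ (key.trans (congrArg _ ?_))
    · refine setIntegral_congr_fun hΩ.measurableSet fun z hz => ?_
      have hd := h.deriv_ne_zero z hz
      simp only [hψ, h.deriv_invFunOn hΩ hz, h.invFunOn_apply hz, Function.comp, norm_inv]
      field_simp [norm_ne_zero_iff.2 hd]
    · refine setIntegral_congr_fun hΩ.measurableSet fun z hz => ?_
      have hd := h.deriv_ne_zero z hz
      simp only [hψ, h.deriv_invFunOn hΩ hz, h.invFunOn_apply hz, pullbackGradient]
      rw [← mul_assoc]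
      congr 1
      have e : v * conj (conj (deriv φ z) * g (φ z)) = (‖deriv φ z‖ ^ 2 : ℝ) *
          (v * conj ((deriv φ z)⁻¹) * conj (g (φ z))) := by
        have hcd : conj (deriv φ z) ≠ 0 := (map_ne_zero _).2 hd
        rw [← Complex.normSq_eq_norm_sq, ← Complex.mul_conj, map_inv₀, map_mul, Complex.conj_conj]
        field_simp
      rw [Complex.inner, Complex.inner, e, Complex.re_ofReal_mul]

/-! ### Integrability implies boundedness: Hölder's inequality -/

theorem eLpNorm_ofReal {f : ℂ → ℂ} {r : ℝ} (hr : 0 < r) (μ : Measure ℂ) :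
    eLpNorm f (ENNReal.ofReal r) μ = (∫⁻ z, ‖f z‖ₑ ^ r ∂μ) ^ (1 / r) := by
  rw [eLpNorm_eq_lintegral_rpow_enorm_toReal (ENNReal.ofReal_pos.2 hr).ne' ENNReal.ofReal_ne_top,
    ENNReal.toReal_ofReal hr.le]

theorem enorm_pullbackGradient (φ g : ℂ → ℂ) (z : ℂ) :
    ‖pullbackGradient φ g z‖ₑ = ‖deriv φ z‖ₑ * ‖g (φ z)‖ₑ := by
  rw [pullbackGradient, enorm_mul]
  congr 1
  simp [enorm_eq_nnnorm]

namespace IsConformalHomeo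

variable {φ : ℂ → ℂ} {Ω Ω' : Set ℂ} {p s : ℝ}

/-- With `d = p + s - 2` one has `q = 2s/d + s(p - 2)/d`, so the integrand `|φ'|^q |g ∘ φ|^q`
factors as `(|φ'|² |g ∘ φ|^p)^(s/d) · |φ'|^(s(p - 2)/d)`. Hölder with exponents `d/s` and `d/(p -
2)` applies, and the Jacobian in the first factor turns it into an integral over `Ω'`. -/
theorem eLpNorm_pullbackGradient_le (h : IsConformalHomeo φ Ω Ω') (hΩ : IsOpen Ω) (hp : 2 < p)
    (hs : 0 < s) {g : ℂ → ℂ} (hg : LocallyIntegrableOn g Ω') :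
    eLpNorm (pullbackGradient φ g) (ENNReal.ofReal (p * s / (p + s - 2))) (volume.restrict Ω)
      ≤ (∫⁻ z in Ω, ‖deriv φ z‖ₑ ^ s) ^ ((p - 2) / (p * s)) *
        eLpNorm g (ENNReal.ofReal p) (volume.restrict Ω') := by
  have hp0 : 0 < p := by linarith
  have hps : 0 < p + s - 2 := by linarith
  have hp2 : 0 < p - 2 := by linarith
  set q := p * s / (p + s - 2) with hq
  have hq0 : 0 < q := by positivity
  have hconj : ((p + s - 2) / s).HolderConjugate ((p + s - 2) / (p - 2)) := by
    rw [Real.holderConjugate_iff]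
    refine ⟨(one_lt_div hs).2 (by linarith), ?_⟩
    field_simp
    ring
  have hφm : AEMeasurable (fun z => ‖deriv φ z‖ₑ) (volume.restrict Ω) :=
    ((h.continuousOn_deriv hΩ).aestronglyMeasurable hΩ.measurableSet).enorm
  have hgm : AEMeasurable (fun z => ‖g (φ z)‖ₑ) (volume.restrict Ω) :=
    (h.locallyIntegrableOn_comp hΩ hg).aestronglyMeasurable.enorm
  have hint : ∫⁻ z in Ω, ‖pullbackGradient φ g z‖ₑ ^ q
      ≤ (∫⁻ w in Ω', ‖g w‖ₑ ^ p) ^ (s / (p + s - 2)) *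
        (∫⁻ z in Ω, ‖deriv φ z‖ₑ ^ s) ^ ((p - 2) / (p + s - 2)) := by
    have key := ENNReal.lintegral_mul_le_Lp_mul_Lq (volume.restrict Ω) hconj
      (f := fun z => (‖deriv φ z‖ₑ ^ 2 * ‖g (φ z)‖ₑ ^ p) ^ (s / (p + s - 2)))
      (g := fun z => ‖deriv φ z‖ₑ ^ (s * (p - 2) / (p + s - 2)))
      (((hφm.pow_const (2 : ℕ)).mul (hgm.pow_const p)).pow_const (s / (p + s - 2)))
      (hφm.pow_const _)
    simp only [← ENNReal.rpow_mul, one_div_div] at key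
    rw [h.lintegral_comp hΩ]
    convert key using 1
    · refine setLIntegral_congr_fun hΩ.measurableSet fun z hz => ?_
      have h0 : ‖deriv φ z‖ₑ ≠ 0 := enorm_ne_zero.2 (h.deriv_ne_zero z hz)
      simp only [Pi.mul_apply]
      rw [enorm_pullbackGradient, ENNReal.mul_rpow_of_nonneg _ _ hq0.le,
        ENNReal.mul_rpow_of_nonneg _ _ (by positivity), ← ENNReal.rpow_natCast,
        ← ENNReal.rpow_mul, ← ENNReal.rpow_mul, mul_right_comm,
        ← ENNReal.rpow_add _ _ h0 enorm_ne_top]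
      congr 2
      · rw [hq]; field_simp; push_cast; ring
      · rw [hq]; ring
    · have e1 : s / (p + s - 2) * ((p + s - 2) / s) = 1 := by field_simp
      have e2 : s * (p - 2) / (p + s - 2) * ((p + s - 2) / (p - 2)) = s := by field_simp
      simp only [e1, e2, ENNReal.rpow_one]
  rw [eLpNorm_ofReal hq0, eLpNorm_ofReal hp0]
  refine (ENNReal.rpow_le_rpow hint (by positivity)).trans_eq ?_
  rw [ENNReal.mul_rpow_of_nonneg _ _ (by positivity), ← ENNReal.rpow_mul, ← ENNReal.rpow_mul,
    mul_comm]
  congr 2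
  · rw [hq]; field_simp
  · rw [hq]; field_simp

theorem generatesBoundedComposition (h : IsConformalHomeo φ Ω Ω') (hΩ : IsOpen Ω) (hp : 2 < p)
    (hs : 0 < s) (hB : BrennanIntegrable φ Ω s) :
    GeneratesBoundedComposition φ Ω Ω' (ENNReal.ofReal p)
      (ENNReal.ofReal (p * s / (p + s - 2))) := by
  have hp2 : 0 < p - 2 := by linarith
  set C := (∫⁻ z in Ω, ‖deriv φ z‖ₑ ^ s) ^ ((p - 2) / (p * s))
  have hC : C ≠ ∞ := ENNReal.rpow_ne_top_of_nonneg
    (div_nonneg hp2.le (mul_nonneg (by linarith) hs.le)) (ne_of_lt hB)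
  have bound : ∀ f : ℂ → ℝ, ∀ g, HasWeakGradient f g Ω' →
      seminormL1 Ω (ENNReal.ofReal (p * s / (p + s - 2))) (f ∘ φ)
        ≤ C * seminormL1 Ω' (ENNReal.ofReal p) f := fun f g hg => by
    rw [seminorm_eq hΩ (hg.comp h hΩ), seminorm_eq (h.isOpen_target hΩ) hg]
    exact h.eLpNorm_pullbackGradient_le hΩ hp hs hg.locallyIntegrableOn_gradient
  refine ⟨fun f ⟨⟨g, hg⟩, hf⟩ => ⟨⟨_, hg.comp h hΩ⟩, ?_⟩, C.toNNReal, fun f ⟨⟨g, hg⟩, _⟩ => ?_⟩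
  · exact (bound f g hg).trans_lt (ENNReal.mul_lt_top hC.lt_top hf)
  · rw [ENNReal.coe_toNNReal hC]
    exact bound f g hg

end IsConformalHomeo

/-! ### From gradients to functions by rapid oscillation -/

/-- The classical gradient `∂u/∂x + i ∂u/∂y`. -/
def classicalGradient (u : ℂ → ℝ) (w : ℂ) : ℂ := ⟨fderiv ℝ u w 1, fderiv ℝ u w Complex.I⟩

theorem continuous_classicalGradient {u : ℂ → ℝ} (hu : ContDiff ℝ (⊤ : ℕ∞) u) :
    Continuous (classicalGradient u) := by
  have h (v : ℂ) : Continuous fun w => fderiv ℝ u w v :=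
    (hu.continuous_fderiv (by simp)).clm_apply continuous_const
  exact Complex.equivRealProdCLM.symm.continuous.comp ((h 1).prodMk (h Complex.I))

theorem hasCompactSupport_classicalGradient {u : ℂ → ℝ} (hc : HasCompactSupport u) :
    HasCompactSupport (classicalGradient u) := by
  refine (hc.fderiv ℝ).mono fun w hw h => hw ?_
  simp only [classicalGradient, h]
  rfl

theorem inner_classicalGradient (u : ℂ → ℝ) (w v : ℂ) :
    inner ℝ (classicalGradient u w) v = fderiv ℝ u w v := by
  conv_rhs => rw [← Complex.re_add_im v]
  have : (v.re : ℂ) + v.im * Complex.I = v.re • (1 : ℂ) + v.im • Complex.I := by simp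
  rw [this, map_add, map_smul, map_smul, classicalGradient, Complex.inner]
  simp

theorem hasWeakGradient_classicalGradient {u : ℂ → ℝ} (hu : ContDiff ℝ (⊤ : ℕ∞) u) (U : Set ℂ) :
    HasWeakGradient u (classicalGradient u) U where
  locallyIntegrableOn := hu.continuous.locallyIntegrable.locallyIntegrableOn U
  locallyIntegrableOn_gradient :=
    (continuous_classicalGradient hu).locallyIntegrable.locallyIntegrableOn U
  integral_eq η hη hc hs v := by
    have hη0 : ∀ z ∉ U, η z = 0 := fun z hz => image_eq_zero_of_notMem_tsupport fun h => hz (hs h)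
    have hη1 : ∀ z ∉ U, fderiv ℝ η z v = 0 := fun z hz =>
      image_eq_zero_of_notMem_tsupport (f := fun z => fderiv ℝ η z v)
        fun h => hz (hs (tsupport_fderiv_apply_subset ℝ v h))
    rw [setIntegral_eq_integral_of_forall_compl_eq_zero fun z hz => by rw [hη1 z hz, mul_zero],
      setIntegral_eq_integral_of_forall_compl_eq_zero fun z hz => by rw [hη0 z hz, mul_zero]]
    simp_rw [inner_classicalGradient]
    have c1 : Continuous fun z => fderiv ℝ u z v :=
      (hu.continuous_fderiv (by simp)).clm_apply continuous_const
    have c2 : Continuous fun z => fderiv ℝ η z v :=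
      (hη.continuous_fderiv (by simp)).clm_apply continuous_const
    exact integral_mul_fderiv_eq_neg_fderiv_mul_of_integrable
      ((c1.mul hη.continuous).integrable_of_hasCompactSupport hc.mul_left)
      ((hu.continuous.mul c2).integrable_of_hasCompactSupport (hc.fderiv_apply ℝ v).mul_left)
      ((hu.continuous.mul hη.continuous).integrable_of_hasCompactSupport hc.mul_left)
      (fun x _ => hu.differentiable (by simp) x) (fun x _ => hη.differentiable (by simp) x)

/-- The gradient of a function modulated by a plane wave of frequency `n`. -/
theorem classicalGradient_mul_sin {u : ℂ → ℝ} (hu : Differentiable ℝ u) {n : ℝ} (hn : n ≠ 0)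
    (c : ℝ) (w : ℂ) :
    classicalGradient (fun w => u w * (n⁻¹ * Real.sin (n * w.re + c))) w
      = (u w * Real.cos (n * w.re + c) : ℝ)
        + (n⁻¹ * Real.sin (n * w.re + c) : ℝ) * classicalGradient u w := by
  have h1 : HasFDerivAt (fun w : ℂ => n * w.re + c) (n • Complex.reCLM) w :=
    (Complex.reCLM.hasFDerivAt.const_mul n).add_const c
  have h2 : HasFDerivAt (fun w => u w * (n⁻¹ * Real.sin (n * w.re + c))) _ w :=
    (hu w).hasFDerivAt.mul (h1.sin.const_mul n⁻¹)
  rw [classicalGradient, h2.fderiv]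
  refine Complex.ext ?_ ?_ <;>
  simp only [classicalGradient, Complex.add_re, Complex.add_im, Complex.ofReal_re,
    Complex.ofReal_im, Complex.re_ofReal_mul, Complex.im_ofReal_mul] <;> simp
  exact Or.inl (by field_simp)

namespace IsConformalHomeo

variable {φ : ℂ → ℂ} {Ω Ω' : Set ℂ} {p q : ℝ≥0∞} {K : ℝ≥0}

theorem eLpNorm_pullback_classicalGradient_le (h : IsConformalHomeo φ Ω Ω') (hΩ : IsOpen Ω)
    (hK : ∀ f : ℂ → ℝ, MemL1 Ω' p f → seminormL1 Ω q (f ∘ φ) ≤ K * seminormL1 Ω' p f)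
    {u : ℂ → ℝ} (hu : ContDiff ℝ (⊤ : ℕ∞) u) (hc : HasCompactSupport u) :
    eLpNorm (pullbackGradient φ (classicalGradient u)) q (volume.restrict Ω)
      ≤ K * eLpNorm (classicalGradient u) p (volume.restrict Ω') := by
  have hw := hasWeakGradient_classicalGradient hu Ω'
  have e := seminorm_eq (h.isOpen_target hΩ) hw p
  rw [← e, ← seminorm_eq hΩ (hw.comp h hΩ)]
  refine hK u ⟨⟨_, hw⟩, ?_⟩
  rw [e]
  exact ((continuous_classicalGradient hu).memLp_of_hasCompactSupport
    (hasCompactSupport_classicalGradient hc)).2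

/-- The gradient of `u sin(nx + c) / n` is `u cos(nx + c)` plus a remainder `R` with `|R| ≤ |∇u| /
n`. The remainder is paid for twice, once in `L^p(Ω')` and once, after pullback, in `L^q(Ω)`; hence
the factor `2`. -/
theorem eLpNorm_pullback_mul_cos_le (h : IsConformalHomeo φ Ω Ω') (hΩ : IsOpen Ω)
    (hp : 1 ≤ p) (hq : 1 ≤ q)
    (hK : ∀ f : ℂ → ℝ, MemL1 Ω' p f → seminormL1 Ω q (f ∘ φ) ≤ K * seminormL1 Ω' p f)
    {u : ℂ → ℝ} (hu : ContDiff ℝ (⊤ : ℕ∞) u) (hc : HasCompactSupport u) {n : ℝ} (hn : 0 < n)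
    (c : ℝ) :
    eLpNorm (pullbackGradient φ fun w => (u w * Real.cos (n * w.re + c) : ℝ)) q (volume.restrict Ω)
      ≤ K * (eLpNorm (fun w => (u w : ℂ)) p (volume.restrict Ω') +
        ENNReal.ofReal n⁻¹ * (2 * eLpNorm (classicalGradient u) p (volume.restrict Ω'))) := by
  set f : ℂ → ℝ := fun w => u w * (n⁻¹ * Real.sin (n * w.re + c)) with hf
  set G : ℂ → ℂ := fun w => (u w * Real.cos (n * w.re + c) : ℝ)
  set R : ℂ → ℂ := fun w => (n⁻¹ * Real.sin (n * w.re + c) : ℝ) * classicalGradient u w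
  have hre : ContDiff ℝ (⊤ : ℕ∞) fun w : ℂ => n * w.re + c :=
    (contDiff_const.mul Complex.reCLM.contDiff).add contDiff_const
  have hfs : ContDiff ℝ (⊤ : ℕ∞) f := hu.mul (contDiff_const.mul hre.sin)
  have hfc : HasCompactSupport f := hc.mul_right
  have hgrad : classicalGradient f = fun w => G w + R w := funext fun w =>
    classicalGradient_mul_sin (hu.differentiable (by simp)) hn.ne' c w
  have hGc : Continuous G :=
    Complex.continuous_ofReal.comp (hu.continuous.mul hre.cos.continuous)
  have hRc : Continuous R :=
    (Complex.continuous_ofReal.comp (continuous_const.mul hre.sin.continuous)).mul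
      (continuous_classicalGradient hu)
  have hsin : ∀ w : ℂ, ‖((n⁻¹ * Real.sin (n * w.re + c) : ℝ) : ℂ)‖ ≤ n⁻¹ := fun w => by
    rw [Complex.norm_real, norm_mul, Real.norm_of_nonneg (inv_nonneg.2 hn.le)]
    exact mul_le_of_le_one_right (inv_nonneg.2 hn.le) (Real.abs_sin_le_one _)
  have meas : ∀ F : ℂ → ℂ, Continuous F →
      AEStronglyMeasurable (pullbackGradient φ F) (volume.restrict Ω) := fun F hF =>
    (h.locallyIntegrableOn_pullbackGradient hΩ
      (hF.locallyIntegrable.locallyIntegrableOn Ω')).aestronglyMeasurable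
  have hG : eLpNorm G p (volume.restrict Ω') ≤ eLpNorm (fun w => (u w : ℂ)) p (volume.restrict Ω') :=
    eLpNorm_mono fun w => by
      simp only [G, Complex.norm_real, norm_mul]
      exact mul_le_of_le_one_right (norm_nonneg _) (Real.abs_cos_le_one _)
  have hR : eLpNorm R p (volume.restrict Ω')
      ≤ ENNReal.ofReal n⁻¹ * eLpNorm (classicalGradient u) p (volume.restrict Ω') :=
    eLpNorm_le_mul_eLpNorm_of_ae_le_mul (Eventually.of_forall fun w => by
      simp only [R, norm_mul (_ : ℂ)]
      exact mul_le_mul_of_nonneg_right (hsin w) (norm_nonneg _)) p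
  have hTR : eLpNorm (pullbackGradient φ R) q (volume.restrict Ω)
      ≤ ENNReal.ofReal n⁻¹ * (K * eLpNorm (classicalGradient u) p (volume.restrict Ω')) := by
    refine (eLpNorm_le_mul_eLpNorm_of_ae_le_mul (g := pullbackGradient φ (classicalGradient u))
      (c := n⁻¹) (Eventually.of_forall fun z => ?_) q).trans
      (mul_le_mul_right (h.eLpNorm_pullback_classicalGradient_le hΩ hK hu hc) _)
    simp only [pullbackGradient, R, norm_mul (_ : ℂ)]
    rw [mul_left_comm]
    exact mul_le_mul_of_nonneg_right (hsin _) (by positivity)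
  have hTG : pullbackGradient φ G
      = pullbackGradient φ (classicalGradient f) - pullbackGradient φ R := by
    funext z
    simp only [pullbackGradient, hgrad, Pi.sub_apply]
    ring
  calc eLpNorm (pullbackGradient φ G) q (volume.restrict Ω)
      ≤ eLpNorm (pullbackGradient φ (classicalGradient f)) q (volume.restrict Ω)
        + eLpNorm (pullbackGradient φ R) q (volume.restrict Ω) := by
        rw [hTG]
        exact eLpNorm_sub_le (meas _ (continuous_classicalGradient hfs)) (meas _ hRc) hq
    _ ≤ K * eLpNorm (fun w => G w + R w) p (volume.restrict Ω')
        + ENNReal.ofReal n⁻¹ * (K * eLpNorm (classicalGradient u) p (volume.restrict Ω')) := by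
        rw [← hgrad]
        exact add_le_add (h.eLpNorm_pullback_classicalGradient_le hΩ hK hfs hfc) hTR
    _ ≤ K * (eLpNorm (fun w => (u w : ℂ)) p (volume.restrict Ω')
          + ENNReal.ofReal n⁻¹ * eLpNorm (classicalGradient u) p (volume.restrict Ω'))
        + ENNReal.ofReal n⁻¹ * (K * eLpNorm (classicalGradient u) p (volume.restrict Ω')) := by
        gcongr
        exact (eLpNorm_add_le hGc.aestronglyMeasurable hRc.aestronglyMeasurable hp).trans
          (add_le_add hG hR)
    _ = _ := by ring

/-- Boundedness of the composition operator gives a weighted inequality for functions, not only for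
gradients: gradients of rapidly oscillating functions are nearly arbitrary in modulus. -/
theorem eLpNorm_pullback_ofReal_le (h : IsConformalHomeo φ Ω Ω') (hΩ : IsOpen Ω)
    (hp : 1 ≤ p) (hq : 1 ≤ q)
    (hK : ∀ f : ℂ → ℝ, MemL1 Ω' p f → seminormL1 Ω q (f ∘ φ) ≤ K * seminormL1 Ω' p f)
    {u : ℂ → ℝ} (hu : ContDiff ℝ (⊤ : ℕ∞) u) (hc : HasCompactSupport u) :
    eLpNorm (pullbackGradient φ fun w => (u w : ℂ)) q (volume.restrict Ω)
      ≤ 2 * K * eLpNorm (fun w => (u w : ℂ)) p (volume.restrict Ω') := by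
  set N := eLpNorm (fun w => (u w : ℂ)) p (volume.restrict Ω')
  set A := eLpNorm (classicalGradient u) p (volume.restrict Ω')
  have hA : A ≠ ∞ := ((continuous_classicalGradient hu).memLp_of_hasCompactSupport
    (hasCompactSupport_classicalGradient hc)).2.ne
  have bound : ∀ n : ℝ, 0 < n → eLpNorm (pullbackGradient φ fun w => (u w : ℂ)) q
      (volume.restrict Ω) ≤ 2 * (K * (N + ENNReal.ofReal n⁻¹ * (2 * A))) := fun n hn => by
    set C : ℝ → ℂ → ℂ := fun c => pullbackGradient φ fun w => (u w * Real.cos (n * w.re + c) : ℝ)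
    have meas : ∀ c, AEStronglyMeasurable (C c) (volume.restrict Ω) := fun c => by
      refine (h.locallyIntegrableOn_pullbackGradient hΩ
        (Continuous.locallyIntegrable ?_ |>.locallyIntegrableOn Ω')).aestronglyMeasurable
      have := hu.continuous
      fun_prop
    have hle : ∀ c, eLpNorm (C c) q (volume.restrict Ω)
        ≤ K * (N + ENNReal.ofReal n⁻¹ * (2 * A)) :=
      fun c => h.eLpNorm_pullback_mul_cos_le hΩ hp hq hK hu hc hn c
    -- The phases `0` and `-π/2` produce a cosine and a sine, and `|cos| + |sin| ≥ 1` recovers `|u|`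
    -- at the cost of a factor `2`.
    refine (eLpNorm_mono_real (g := fun z => ‖C 0 z‖ + ‖C (-(Real.pi / 2)) z‖) fun z => ?_).trans
      ((eLpNorm_add_le (meas 0).norm (meas (-(Real.pi / 2))).norm hq).trans ?_)
    · simp only [C, pullbackGradient, norm_mul (_ : ℂ), Complex.norm_real, ← mul_add, add_zero,
        norm_mul (_ : ℝ), ← sub_eq_add_neg, Real.cos_sub_pi_div_two]
      refine mul_le_mul_of_nonneg_left (le_mul_of_one_le_right (norm_nonneg _) ?_) (norm_nonneg _)
      set x := n * (φ z).re
      have h1 := Real.sin_sq_add_cos_sq x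
      have h2 := abs_nonneg (Real.cos x)
      have h3 := abs_nonneg (Real.sin x)
      rw [Real.norm_eq_abs, Real.norm_eq_abs]
      nlinarith [sq_abs (Real.cos x), sq_abs (Real.sin x), mul_nonneg h2 h3]
    · rw [eLpNorm_norm, eLpNorm_norm, two_mul]
      exact add_le_add (hle _) (hle _)
  have lim : Tendsto (fun n : ℝ => 2 * ((K : ℝ≥0∞) * (N + ENNReal.ofReal n⁻¹ * (2 * A)))) atTop
      (𝓝 (2 * (K * (N + ENNReal.ofReal 0 * (2 * A))))) := by
    refine ENNReal.Tendsto.const_mul (ENNReal.Tendsto.const_mul (tendsto_const_nhds.add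
      (ENNReal.Tendsto.mul_const (ENNReal.tendsto_ofReal tendsto_inv_atTop_zero) (Or.inr ?_)))
      (Or.inr ENNReal.coe_ne_top)) (Or.inr ENNReal.ofNat_ne_top)
    exact ENNReal.mul_ne_top ENNReal.ofNat_ne_top hA
  rw [ENNReal.ofReal_zero, zero_mul, add_zero, ← mul_assoc] at lim
  exact ge_of_tendsto lim ((eventually_gt_atTop 0).mono bound)

end IsConformalHomeo

/-! ### Boundedness implies integrability: extremal test functions and exhaustion -/

theorem enorm_norm_rpow {c : ℂ} (hc : c ≠ 0) (a : ℝ) : ‖‖c‖ ^ a‖ₑ = ‖c‖ₑ ^ a := by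
  rw [Real.enorm_of_nonneg (by positivity), ← ENNReal.ofReal_rpow_of_pos (norm_pos_iff.2 hc),
    ofReal_norm]

/-- Dividing by `I ^ b` requires `I ≠ ∞`; this is why the converse works with a cutoff. -/
theorem le_rpow_of_rpow_le_mul_rpow {I C : ℝ≥0∞} {a b : ℝ} (hab : b < a)
    (hI : I ≠ ∞) (h : I ^ a ≤ C * I ^ b) : I ≤ C ^ (1 / (a - b)) := by
  rcases eq_or_ne I 0 with rfl | h0
  · exact zero_le
  have h1 : I ^ (a - b) ≤ C := by
    rw [ENNReal.rpow_sub _ _ h0 hI]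
    exact ENNReal.div_le_of_le_mul h
  have h2 := ENNReal.rpow_le_rpow h1 (one_div_nonneg.2 (sub_pos.2 hab).le)
  rwa [← ENNReal.rpow_mul, mul_one_div_cancel (sub_pos.2 hab).ne', ENNReal.rpow_one] at h2

namespace IsConformalHomeo

variable {φ : ℂ → ℂ} {Ω Ω' : Set ℂ} {p s : ℝ} {K : ℝ≥0}

/-- The weighted inequality of `eLpNorm_pullback_ofReal_le` for `χ * |ψ'| ^ ((2 - s) / p)`, where `ψ` is the inverse of `φ` and `χ` a cutoff. -/
theorem lintegral_cutoff_le (h : IsConformalHomeo φ Ω Ω') (hΩ : IsOpen Ω) (hp : 2 < p)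
    (hs : 1 ≤ s)
    (hK : ∀ f : ℂ → ℝ, MemL1 Ω' (ENNReal.ofReal p) f →
      seminormL1 Ω (ENNReal.ofReal (p * s / (p + s - 2))) (f ∘ φ)
        ≤ K * seminormL1 Ω' (ENNReal.ofReal p) f)
    {χ : ℂ → ℝ} (hχ : ContDiff ℝ (⊤ : ℕ∞) χ) (hc : HasCompactSupport χ) (hχΩ' : tsupport χ ⊆ Ω')
    (hχ1 : ∀ w, ‖χ w‖ₑ ≤ 1) :
    ∫⁻ z in Ω, ‖χ (φ z)‖ₑ ^ (p * s / (p + s - 2)) * ‖deriv φ z‖ₑ ^ s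
      ≤ (2 * K : ℝ≥0∞) ^ (p * s / (p - 2)) := by
  have hp0 : 0 < p := by linarith
  have hs0 : 0 < s := by linarith
  have hps : 0 < p + s - 2 := by linarith
  have hp2 : 0 < p - 2 := by linarith
  set q := p * s / (p + s - 2) with hq
  have hq0 : 0 < q := by positivity
  -- The bound `1 ≤ q`, needed for the triangle inequality in `L^q`, amounts to `(p - 1)(s - 1) + 1
  -- ≥ 0`; `q ≤ p` amounts to `2 ≤ p`.
  have hq1 : 1 ≤ q := by
    rw [hq, one_le_div hps]; nlinarith
  have hqp : q ≤ p := by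
    rw [hq, div_le_iff₀ hps]; nlinarith
  have hΩ' := h.isOpen_target hΩ
  have hi := h.invFunOn hΩ
  set I := ∫⁻ z in Ω, ‖χ (φ z)‖ₑ ^ q * ‖deriv φ z‖ₑ ^ s
  set ψ := Function.invFunOn φ Ω with hψ
  -- Since `|ψ'| ∘ φ = |φ'|⁻¹`, this exponent yields `|φ'|^s` on both sides: `q (1 + (s - 2)/p) = s`
  -- on the left, `2 + (s - 2) = s` on the right with the Jacobian.
  set F : ℂ → ℝ := fun w => χ w * ‖deriv ψ w‖ ^ ((2 - s) / p) with hF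
  have hF0 : ∀ w ∈ Ω', w ∉ tsupport χ → F w = 0 := fun w _ hw => by
    rw [hF]; simp only [image_eq_zero_of_notMem_tsupport hw, zero_mul]
  have hFs : ContDiffOn ℝ (⊤ : ℕ∞) F Ω' := hχ.contDiffOn.mul
    (((hi.contDiffOn_deriv hΩ').norm ℝ hi.deriv_ne_zero).rpow_const_of_ne
      fun w hw => norm_ne_zero_iff.2 (hi.deriv_ne_zero w hw))
  set u : ℂ → ℝ := Ω'.indicator F with hu
  have hus : ContDiff ℝ (⊤ : ℕ∞) u := contDiff_indicator hΩ' hc hχΩ' hFs hF0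
  have huc : HasCompactSupport u :=
    hc.of_isClosed_subset isClosed_closure (tsupport_indicator_subset hc hF0)
  have huφ : ∀ z ∈ Ω, ‖(u (φ z) : ℂ)‖ₑ = ‖χ (φ z)‖ₑ * ‖deriv φ z‖ₑ ^ ((s - 2) / p) := by
    intro z hz
    have hd := h.deriv_ne_zero z hz
    have e : u (φ z) = χ (φ z) * ‖deriv φ z‖ ^ ((s - 2) / p) := by
      rw [hu, indicator_of_mem (h.bijOn.mapsTo hz), hF]
      simp only [hψ, h.deriv_invFunOn hΩ hz, norm_inv]
      rw [Real.inv_rpow (norm_nonneg _), ← Real.rpow_neg (norm_nonneg _), ← neg_div, neg_sub]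
    rw [← ofReal_norm, Complex.norm_real, ofReal_norm, e, enorm_mul, enorm_norm_rpow hd]
  have e1 : eLpNorm (pullbackGradient φ fun w => (u w : ℂ)) (ENNReal.ofReal q) (volume.restrict Ω)
      = I ^ (1 / q) := by
    rw [eLpNorm_ofReal hq0]
    congr 1
    refine setLIntegral_congr_fun hΩ.measurableSet fun z hz => ?_
    have h0 : ‖deriv φ z‖ₑ ≠ 0 := enorm_ne_zero.2 (h.deriv_ne_zero z hz)
    rw [enorm_pullbackGradient, huφ z hz, mul_left_comm, ENNReal.mul_rpow_of_nonneg _ _ hq0.le]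
    congr 1
    nth_rewrite 1 [← ENNReal.rpow_one ‖deriv φ z‖ₑ]
    rw [← ENNReal.rpow_add _ _ h0 enorm_ne_top, ← ENNReal.rpow_mul]
    congr 1
    rw [hq]; field_simp; ring
  have e2 : eLpNorm (fun w => (u w : ℂ)) (ENNReal.ofReal p) (volume.restrict Ω')
      ≤ I ^ (1 / p) := by
    rw [eLpNorm_ofReal hp0]
    refine ENNReal.rpow_le_rpow ?_ (by positivity)
    rw [h.lintegral_comp hΩ]
    refine setLIntegral_mono' hΩ.measurableSet fun z hz => ?_
    have h0 : ‖deriv φ z‖ₑ ≠ 0 := enorm_ne_zero.2 (h.deriv_ne_zero z hz)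
    rw [huφ z hz, ENNReal.mul_rpow_of_nonneg _ _ hp0.le, mul_left_comm, ← ENNReal.rpow_mul,
      ← ENNReal.rpow_natCast, ← ENNReal.rpow_add _ _ h0 enorm_ne_top, div_mul_cancel₀ _ hp0.ne',
      Nat.cast_ofNat, add_sub_cancel]
    -- The two sides carry different powers of the cutoff; `|χ|^p ≤ |χ|^q` because `|χ| ≤ 1` and `q
    -- ≤ p`.
    exact mul_le_mul_left (ENNReal.rpow_le_rpow_of_exponent_ge (hχ1 _) hqp) _
  have key := h.eLpNorm_pullback_ofReal_le hΩ
    (ENNReal.one_le_ofReal.2 (by linarith)) (ENNReal.one_le_ofReal.2 hq1) hK hus huc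
  have hfin : eLpNorm (fun w => (u w : ℂ)) (ENNReal.ofReal p) (volume.restrict Ω') < ∞ :=
    ((Complex.continuous_ofReal.comp hus.continuous).memLp_of_hasCompactSupport
      (huc.comp_left Complex.ofReal_zero)).2
  rw [e1] at key
  -- Finiteness comes from the weighted inequality itself, whose right side is the norm of a
  -- continuous compactly supported function.
  have hI : I ≠ ∞ := by
    intro hI
    rw [hI, ENNReal.top_rpow_of_pos (by positivity)] at key
    exact (ENNReal.mul_lt_top (ENNReal.mul_lt_top ENNReal.ofNat_lt_top ENNReal.coe_lt_top)
      hfin).not_ge key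
  have hexp : 1 / (1 / q - 1 / p) = p * s / (p - 2) := by
    have e : 1 / q - 1 / p = (p - 2) / (p * s) := by rw [hq]; field_simp; ring
    rw [e, one_div_div]
  rw [← hexp]
  refine le_rpow_of_rpow_le_mul_rpow ?_ hI
    (key.trans (mul_le_mul_right e2 _))
  rw [← sub_pos, ← one_div_pos, hexp]
  positivity

/-- A conformal homeomorphism onto the disc that generates a bounded composition operator satisfies
Brennan's integrability condition. -/
theorem brennanIntegrable (h : IsConformalHomeo φ Ω disc) (hΩ : IsOpen Ω) (hp : 2 < p)
    (hs : 1 ≤ s)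
    (hG : GeneratesBoundedComposition φ Ω disc (ENNReal.ofReal p)
      (ENNReal.ofReal (p * s / (p + s - 2)))) :
    BrennanIntegrable φ Ω s := by
  obtain ⟨K, hK⟩ := hG.2
  -- The shift by `2` keeps every radius positive, as the inner radius of a bump function must be.
  set S : ℕ → Set ℂ := fun n => Ω ∩ φ ⁻¹' Metric.ball 0 (1 - 1 / ((n : ℝ) + 2))
  have hS : ⋃ n, S n = Ω := by
    refine subset_antisymm (iUnion_subset fun n => inter_subset_left) fun z hz => ?_
    have h1 : ‖φ z‖ < 1 := by simpa using h.bijOn.mapsTo hz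
    obtain ⟨n, hn⟩ := exists_nat_one_div_lt (sub_pos.2 h1)
    refine mem_iUnion.2 ⟨n, hz, mem_ball_zero_iff.2 ?_⟩
    have : 1 / ((n : ℝ) + 2) ≤ 1 / ((n : ℝ) + 1) :=
      one_div_le_one_div_of_le (by positivity) (by linarith)
    linarith
  have hmono : Monotone S := fun m n hmn => inter_subset_inter_right _ <| preimage_mono <|
    Metric.ball_subset_ball <| sub_le_sub_left
      (one_div_le_one_div_of_le (by positivity) (by gcongr)) _
  rw [BrennanIntegrable, ← hS, setLIntegral_iUnion_of_directed _ hmono.directed_le]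
  -- The cutoff estimate does not depend on `n`, so it survives the supremum.
  refine (iSup_le (a := (2 * K : ℝ≥0∞) ^ (p * s / (p - 2))) fun n => ?_).trans_lt
    (ENNReal.rpow_lt_top_of_nonneg (div_nonneg (mul_nonneg (by linarith) (by linarith))
      (by linarith)) (ENNReal.mul_ne_top ENNReal.ofNat_ne_top ENNReal.coe_ne_top))
  have hn1 : 0 < 1 / ((n : ℝ) + 2) := by positivity
  have hn2 : 1 / ((n : ℝ) + 2) < 1 := by
    rw [div_lt_one (by positivity)]; linarith [(Nat.cast_nonneg n : (0 : ℝ) ≤ n)]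
  -- Equal to `1` on the ball defining `S n`; the outer radius lies halfway between that radius and
  -- `1`.
  let χ : ContDiffBump (0 : ℂ) :=
    ⟨1 - 1 / ((n : ℝ) + 2), 1 - 1 / ((n : ℝ) + 2) / 2, by linarith, by linarith⟩
  have hχ : tsupport χ ⊆ disc := by
    rw [χ.tsupport_eq]
    exact Metric.closedBall_subset_ball (by change 1 - 1 / ((n : ℝ) + 2) / 2 < 1; linarith)
  have hSm : MeasurableSet (S n) :=
    (h.differentiableOn.continuousOn.isOpen_inter_preimage hΩ Metric.isOpen_ball).measurableSet
  refine le_trans ?_ (h.lintegral_cutoff_le hΩ hp hs hK χ.contDiff χ.hasCompactSupport hχ fun w => ?_)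
  · refine le_trans (le_of_eq ?_) (lintegral_mono_set (s := S n) inter_subset_left)
    refine setLIntegral_congr_fun hSm fun z hz => ?_
    rw [χ.one_of_mem_closedBall (Metric.ball_subset_closedBall hz.2), enorm_one, ENNReal.one_rpow,
      one_mul]
  · rw [Real.enorm_of_nonneg χ.nonneg]
    exact ENNReal.ofReal_le_one.2 χ.le_one

theorem brennanIntegrable_iff (h : IsConformalHomeo φ Ω disc) (hΩ : IsOpen Ω) (hs : 1 ≤ s) :
    BrennanIntegrable φ Ω s ↔ ∀ p : ℝ, 2 < p →
      GeneratesBoundedComposition φ Ω disc (ENNReal.ofReal p)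
        (ENNReal.ofReal (p * s / (p + s - 2))) :=
  ⟨fun hB _ hp => h.generatesBoundedComposition hΩ hp (by linarith) hB,
    -- Boundedness for a single exponent suffices; `3` is an arbitrary choice above `2`.
    fun hG => h.brennanIntegrable hΩ (p := 3) (by norm_num) hs (hG 3 (by norm_num))⟩

end IsConformalHomeo

end Brennan

end

theorem mainTheorem1 (s : ℝ) (hs : s ∈ Set.Ioo (4 / 3 : ℝ) 4) :
    ((∀ (Ω : Set ℂ) (φ : ℂ → ℂ), Brennan.IsPlaneDomain Ω →
          Brennan.IsConformalHomeo φ Ω Brennan.disc → Brennan.BrennanIntegrable φ Ω s) ↔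
      (∀ (Ω : Set ℂ) (φ : ℂ → ℂ), Brennan.IsPlaneDomain Ω →
          Brennan.IsConformalHomeo φ Ω Brennan.disc →
        ∀ p : ℝ, 2 < p → Brennan.GeneratesBoundedComposition φ Ω Brennan.disc
          (ENNReal.ofReal p) (ENNReal.ofReal (p * s / (p + s - 2))))) ∧
    (∀ Ω : Set ℂ, Brennan.IsPlaneDomain Ω →
      ((∀ φ : ℂ → ℂ, Brennan.IsConformalHomeo φ Ω Brennan.disc →
          Brennan.BrennanIntegrable φ Ω s) ↔
        (∀ φ : ℂ → ℂ, Brennan.IsConformalHomeo φ Ω Brennan.disc →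
          ∀ p : ℝ, 2 < p → Brennan.GeneratesBoundedComposition φ Ω Brennan.disc
            (ENNReal.ofReal p) (ENNReal.ofReal (p * s / (p + s - 2)))))) := by
  have hs1 : 1 ≤ s := by linarith [hs.1]
  -- The equivalence for each individual `φ` passes through both arrangements of the quantifiers.
  exact ⟨forall₄_congr fun Ω φ hΩ h => h.brennanIntegrable_iff hΩ.isOpen hs1,
    fun Ω hΩ => forall₂_congr fun φ h => h.brennanIntegrable_iff hΩ.isOpen hs1⟩
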